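/- All Banach spaces are real. For a metric space $M$ with a base point $0\in M$, let $\mathrm{Lip}_0(M)$ be the space of Lipschitz functions $f:M\to\mathbb{R}$ with $f(0)=0$, normed by $\|f\|_L=\sup_{x\ne y}\frac{|f(x)-f(y)|}{d(x,y)}$. For $m\in M$ let $\delta(m)\in \mathrm{Lip}_0(M)^*$ be the evaluation $f\mapsto f(m)$, and let $\mathcal F(M)=\overline{\mathrm{span}}\{\delta(m):m\in M\}\subset \mathrm{Lip}_0(M)^*$ be the Lipschitz free space over $M$. For Banach spaces $E,F$ let $\mathcal B(E\times F)$ be the Banach space of bounded bilinear forms on $E\times F$ with $\|B\|=\sup\{|B(x,y)|:\|x\|\le 1,\ \|y\|\le 1\}$; for $x\in E$, $y\in F$ let $x\otimes y\in\mathcal B(E\times F)^*$ be the functional $B\mapsto B(x,y)$, and let $E\hat\otimes_\pi F=\overline{\mathrm{span}}\{x\otimes y:x\in E,\ y\in F\}\subset\mathcal B(E\times F)^*$ be the projective tensor product. A Banach space $E$ has the approximation property if for every $\varepsilon>0$ and every compact $K\subset E$ there is a bounded finite rank operator $T:E\to E$ with $\|Tx-x\|\le\varepsilon$ for all $x\in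 K$. Let $M$ be a complete pointed metric space and let $X$ be a Banach space such that $\mathcal F(M)$ or $X$ has the approximation property. Then the set $$\delta(M,X)=\{\delta(m)\otimes x : m\in M,\ x\in X\}$$ is weakly closed in the $X$-valued Lipschitz free space $\mathcal F(M,X):=\mathcal F(M)\hat\otimes_\pi X$. -/

import Mathlib

set_option maxSynthPendingDepth 3

/-! ### The approximation property -/

/-- A real normed space `E` has the approximation property if the identity can be approximated,
uniformly on each compact set, by bounded operators of finite rank. -/
def HasAP (E : Type*) [NormedAddCommGroup E] [NormedSpace ℝ E] : Prop :=
  ∀ ε : ℝ, 0 < ε → ∀ K : Set E, IsCompact K →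
    ∃ T : E →L[ℝ] E, FiniteDimensional ℝ (LinearMap.range (T : E →ₗ[ℝ] E)) ∧
      ∀ x ∈ K, ‖T x - x‖ ≤ ε

/-! ### The projective tensor product -/

/-- The normed space of bounded bilinear forms on `E × F`, in curried form; its norm is
`‖B‖ = sup {|B x y| : ‖x‖ ≤ 1, ‖y‖ ≤ 1}`. -/
abbrev BilForm (E F : Type*) [NormedAddCommGroup E] [NormedSpace ℝ E]
    [NormedAddCommGroup F] [NormedSpace ℝ F] : Type _ :=
  E →L[ℝ] F →L[ℝ] ℝ

section ProjTensor

variable {E F : Type*} [NormedAddCommGroup E] [NormedSpace ℝ E]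
  [NormedAddCommGroup F] [NormedSpace ℝ F]

/-- The elementary tensor `x ⊗ y`, as the functional `B ↦ B x y` on the space of bounded bilinear
forms on `E × F`. -/
noncomputable def evalTensor (x : E) (y : F) : StrongDual ℝ (BilForm E F) :=
  (ContinuousLinearMap.apply ℝ ℝ y).comp (ContinuousLinearMap.apply ℝ (F →L[ℝ] ℝ) x)

theorem evalTensor_apply (x : E) (y : F) (B : BilForm E F) : evalTensor x y B = B x y := rfl

variable (E F) in
/-- The closed linear span of the elementary tensors in the dual of the space of bounded bilinear
forms on `E × F`. -/
noncomputable def projTensorSubmodule : Submodule ℝ (StrongDual ℝ (BilForm E F)) :=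
  (Submodule.span ℝ {t | ∃ (x : E) (y : F), t = evalTensor x y}).topologicalClosure

variable (E F) in
/-- The (completed) projective tensor product of `E` and `F`, with the norm of the dual of the
space of bounded bilinear forms on `E × F`. -/
def ProjTensor : Type _ := projTensorSubmodule E F

noncomputable instance : NormedAddCommGroup (ProjTensor E F) :=
  inferInstanceAs (NormedAddCommGroup (projTensorSubmodule E F))

noncomputable instance : NormedSpace ℝ (ProjTensor E F) :=
  inferInstanceAs (NormedSpace ℝ (projTensorSubmodule E F))

/-- The elementary tensor `x ⊗ y` as an element of the projective tensor product. -/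
noncomputable def tensor (x : E) (y : F) : ProjTensor E F :=
  ⟨evalTensor x y, Submodule.le_topologicalClosure _ (Submodule.subset_span ⟨x, y, rfl⟩)⟩

end ProjTensor

/-! ### Lipschitz functions vanishing at the base point -/

/-- The vector space of real Lipschitz functions on `M` that vanish at the base point `o`. -/
def lipZeroSubmodule (M : Type*) [MetricSpace M] (o : M) : Submodule ℝ (M → ℝ) where
  carrier := {f | (∃ C, LipschitzWith C f) ∧ f o = 0}
  zero_mem' := ⟨⟨0, LipschitzWith.const 0⟩, rfl⟩
  add_mem' := by
    rintro f g ⟨⟨C, hf⟩, hf0⟩ ⟨⟨D, hg⟩, hg0⟩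
    exact ⟨⟨C + D, hf.add hg⟩, by simp [hf0, hg0]⟩
  smul_mem' := by
    rintro c f ⟨⟨C, hf⟩, hf0⟩
    refine ⟨⟨‖c‖₊ * C, LipschitzWith.of_dist_le_mul fun x y => ?_⟩, by simp [hf0]⟩
    have h := mul_le_mul_of_nonneg_left (hf.dist_le_mul x y) (norm_nonneg c)
    simpa only [Pi.smul_apply, dist_smul₀, NNReal.coe_mul, coe_nnnorm, mul_assoc] using h

/-- The space `Lip₀(M)`. This is a type of its own, so that it carries the Lipschitz norm and not
the topology of pointwise convergence. -/
def LipZero (M : Type*) [MetricSpace M] (o : M) : Type _ := lipZeroSubmodule M o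

namespace LipZero

variable {M : Type*} [MetricSpace M] {o : M}

instance : AddCommGroup (LipZero M o) := inferInstanceAs (AddCommGroup (lipZeroSubmodule M o))

instance : Module ℝ (LipZero M o) := inferInstanceAs (Module ℝ (lipZeroSubmodule M o))

instance : CoeFun (LipZero M o) (fun _ => M → ℝ) := ⟨fun f => f.1⟩

theorem ext_fun {f g : LipZero M o} (h : ∀ x, f x = g x) : f = g := Subtype.ext (funext h)

theorem exists_lipschitz (f : LipZero M o) : ∃ C, LipschitzWith C f := f.2.1

theorem map_base (f : LipZero M o) : f o = 0 := f.2.2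

theorem add_apply (f g : LipZero M o) (x : M) : (f + g) x = f x + g x := rfl

theorem zero_apply (x : M) : (0 : LipZero M o) x = 0 := rfl

theorem neg_apply (f : LipZero M o) (x : M) : (-f) x = -f x := rfl

theorem smul_apply (c : ℝ) (f : LipZero M o) (x : M) : (c • f) x = c * f x := rfl

/-- The Lipschitz norm: the supremum of the slopes `|f x - f y| / d(x, y)`. The pairs with `x = y`
contribute `0 / 0 = 0`. -/
noncomputable def lipNorm (f : LipZero M o) : ℝ := ⨆ p : M × M, |f p.1 - f p.2| / dist p.1 p.2

theorem bddAbove_slopes (f : LipZero M o) :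
    BddAbove (Set.range fun p : M × M => |f p.1 - f p.2| / dist p.1 p.2) := by
  obtain ⟨C, hC⟩ := f.exists_lipschitz
  refine ⟨C, ?_⟩
  rintro _ ⟨p, rfl⟩
  exact div_le_of_le_mul₀ dist_nonneg C.2 (hC.dist_le_mul p.1 p.2)

theorem lipNorm_nonneg (f : LipZero M o) : 0 ≤ f.lipNorm :=
  Real.iSup_nonneg fun _ => div_nonneg (abs_nonneg _) dist_nonneg

theorem abs_sub_le (f : LipZero M o) (x y : M) : |f x - f y| ≤ f.lipNorm * dist x y := by
  rcases eq_or_ne x y with rfl | hxy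
  · simp
  · exact (div_le_iff₀ (dist_pos.2 hxy)).1 (le_ciSup f.bddAbove_slopes (x, y))

theorem lipNorm_le {f : LipZero M o} {C : ℝ} (hC : 0 ≤ C)
    (h : ∀ x y, |f x - f y| ≤ C * dist x y) : f.lipNorm ≤ C :=
  Real.iSup_le (fun p => div_le_of_le_mul₀ dist_nonneg hC (h p.1 p.2)) hC

noncomputable instance : NormedAddCommGroup (LipZero M o) :=
  AddGroupNorm.toNormedAddCommGroup
    { toFun := lipNorm
      map_zero' := le_antisymm
        (lipNorm_le le_rfl fun x y => by simp [zero_apply]) (lipNorm_nonneg _)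
      add_le' := fun f g => lipNorm_le (add_nonneg f.lipNorm_nonneg g.lipNorm_nonneg)
        fun x y => by
          have h := abs_add_le (f x - f y) (g x - g y)
          have hf := f.abs_sub_le x y
          have hg := g.abs_sub_le x y
          have e : (f + g) x - (f + g) y = (f x - f y) + (g x - g y) := by
            simp only [add_apply]; ring
          rw [e, add_mul]
          linarith
      neg' := fun f => by
        have e : ∀ x y, |(-f) x - (-f) y| = |f x - f y| := fun x y => by
          rw [neg_apply, neg_apply, ← abs_neg]; congr 1; ring
        simp only [lipNorm, e]
      eq_zero_of_map_eq_zero' := fun f hf => ext_fun fun x => by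
        have h := f.abs_sub_le x o
        rw [show f.lipNorm = 0 from hf, zero_mul, map_base, sub_zero] at h
        exact abs_nonpos_iff.1 h }

theorem norm_def (f : LipZero M o) : ‖f‖ = ⨆ p : M × M, |f p.1 - f p.2| / dist p.1 p.2 := rfl

noncomputable instance : NormedSpace ℝ (LipZero M o) where
  norm_smul_le c f := lipNorm_le (mul_nonneg (norm_nonneg c) f.lipNorm_nonneg) fun x y => by
    rw [smul_apply, smul_apply, ← mul_sub, abs_mul, mul_assoc]
    exact mul_le_mul_of_nonneg_left (f.abs_sub_le x y) (abs_nonneg c)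

end LipZero

/-! ### Lipschitz free spaces -/

/-- The evaluation functional `f ↦ f m` on `Lip₀(M)`. -/
noncomputable def evalDelta {M : Type*} [MetricSpace M] (o m : M) :
    StrongDual ℝ (LipZero M o) :=
  LinearMap.mkContinuous
    { toFun := fun f => f m
      map_add' := fun _ _ => rfl
      map_smul' := fun _ _ => rfl } (dist m o) fun f => by
    have h := f.abs_sub_le m o
    rw [LipZero.map_base, sub_zero, mul_comm] at h
    exact h

/-- The closed linear span of the evaluation functionals in the dual of `Lip₀(M)`. -/
noncomputable def freeSubmodule (M : Type*) [MetricSpace M] (o : M) :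
    Submodule ℝ (StrongDual ℝ (LipZero M o)) :=
  (Submodule.span ℝ (Set.range (evalDelta o))).topologicalClosure

/-- The Lipschitz free space `F(M)`, with the norm of the dual of `Lip₀(M)`. -/
def FreeSpace (M : Type*) [MetricSpace M] (o : M) : Type _ := freeSubmodule M o

noncomputable instance {M : Type*} [MetricSpace M] {o : M} :
    NormedAddCommGroup (FreeSpace M o) :=
  inferInstanceAs (NormedAddCommGroup (freeSubmodule M o))

noncomputable instance {M : Type*} [MetricSpace M] {o : M} : NormedSpace ℝ (FreeSpace M o) :=
  inferInstanceAs (NormedSpace ℝ (freeSubmodule M o))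

/-- The canonical map `δ : M → F(M)`. -/
noncomputable def delta {M : Type*} [MetricSpace M] (o m : M) : FreeSpace M o :=
  ⟨evalDelta o m, Submodule.le_topologicalClosure _ (Submodule.subset_span ⟨m, rfl⟩)⟩

/-- The vector-valued Lipschitz free space `F(M, X)`: the projective tensor product of `F(M)`
and `X`. -/
abbrev FreeSpaceVec (M : Type*) [MetricSpace M] (o : M) (X : Type*)
    [NormedAddCommGroup X] [NormedSpace ℝ X] : Type _ :=
  ProjTensor (FreeSpace M o) X

/-- The set `δ(M, X)` of all `δ(m) ⊗ x` with `m ∈ M` and `x ∈ X`. -/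
def deltaSet (M : Type*) [MetricSpace M] (o : M) (X : Type*)
    [NormedAddCommGroup X] [NormedSpace ℝ X] : Set (FreeSpaceVec M o X) :=
  {z | ∃ (m : M) (x : X), z = tensor (delta o m) x}

/-- A subset of a real normed space is weakly closed if it is closed for the weak topology. -/
def IsWeaklyClosed {E : Type*} [NormedAddCommGroup E] [NormedSpace ℝ E] (S : Set E) : Prop :=
  IsClosed (toWeakSpace ℝ E '' S)

/-! Let `z` be the weak limit of `δ(mᵢ) ⊗ xᵢ` along an ultrafilter. Under the approximation property
`z` is determined by its values on the rank-one forms `f ⊗ g` (`eq_zero_of_forall_rankOne`). If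
these all vanish, `z = 0`. Otherwise fix `f₀`, `g₀` with `c = z(f₀ ⊗ g₀) ≠ 0`. Freezing one factor
gives `γ ∈ F(M)` and `x ∈ X` with `z(f ⊗ g₀) = f(γ)` and `z(f₀ ⊗ g) = g(x)`
(`exists_apply_eq_of_forall_tensor`). On elementary tensors `(f ⊗ g)(f₀ ⊗ g₀) = (f ⊗ g₀)(f₀ ⊗ g)`;
in the limit `c z(f ⊗ g) = f(γ) g(x)`, so `z = c⁻¹ γ ⊗ x`.

It remains to see that `γ`, a weak limit of `g₀(xᵢ) δ(mᵢ)`, is a multiple of some `δ(m)`. The cone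
of such multiples is norm closed by completeness of `M` (`isClosed_deltaCone`), and weak limits of
its elements lie in its norm closure (`mem_deltaCone_of_weak_tendsto`). -/

open Filter Topology

/-! ### Projective tensor products and finite control of their elements -/

section ProjTensor

variable {E F : Type*} [NormedAddCommGroup E] [NormedSpace ℝ E]
  [NormedAddCommGroup F] [NormedSpace ℝ F]

/-- The bilinear form `(x, y) ↦ Φ (x ⊗ y)` induced by a functional `Φ`. -/
noncomputable def inducedForm (Φ : StrongDual ℝ (StrongDual ℝ (BilForm E F))) : BilForm E F :=
  LinearMap.mkContinuous₂
    (LinearMap.mk₂ ℝ (fun x y => Φ (evalTensor x y))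
      (fun x x' y => by
        rw [← map_add]; congr 1; ext B; simp [evalTensor_apply])
      (fun c x y => by
        rw [← map_smul]; congr 1; ext B; simp [evalTensor_apply])
      (fun x y y' => by
        rw [← map_add]; congr 1; ext B; simp [evalTensor_apply])
      (fun c x y => by
        rw [← map_smul]; congr 1; ext B; simp [evalTensor_apply])) ‖Φ‖ fun x y => by
    rw [mul_assoc]
    refine (Φ.le_opNorm _).trans (mul_le_mul_of_nonneg_left ?_ (norm_nonneg _))
    refine ContinuousLinearMap.opNorm_le_bound _ (by positivity) fun B => ?_
    rw [evalTensor_apply]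
    refine (B.le_opNorm₂ x y).trans_eq (by ring)

theorem inducedForm_apply (Φ : StrongDual ℝ (StrongDual ℝ (BilForm E F))) (x : E) (y : F) :
    inducedForm Φ x y = Φ (evalTensor x y) := rfl

/-- A functional and its induced form agree on the projective tensor product. -/
theorem apply_inducedForm (Φ : StrongDual ℝ (StrongDual ℝ (BilForm E F)))
    {z : StrongDual ℝ (BilForm E F)} (hz : z ∈ projTensorSubmodule E F) :
    z (inducedForm Φ) = Φ z := by
  have hle : projTensorSubmodule E F ≤
      LinearMap.ker ((ContinuousLinearMap.apply ℝ ℝ (inducedForm Φ) - Φ :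
        StrongDual ℝ (StrongDual ℝ (BilForm E F))) : StrongDual ℝ (BilForm E F) →ₗ[ℝ] ℝ) := by
    refine Submodule.topologicalClosure_minimal _ (Submodule.span_le.2 ?_)
      (ContinuousLinearMap.isClosed_ker _)
    rintro _ ⟨x, y, rfl⟩
    simp [evalTensor_apply, inducedForm_apply]
  have := hle hz
  simpa [sub_eq_zero] using this

/-- The elementary tensors of elements of the unit balls. -/
def unitTensors (E F : Type*) [NormedAddCommGroup E] [NormedSpace ℝ E]
    [NormedAddCommGroup F] [NormedSpace ℝ F] : Set (StrongDual ℝ (BilForm E F)) :=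
  (fun p : E × F => evalTensor p.1 p.2) '' {p | ‖p.1‖ ≤ 1 ∧ ‖p.2‖ ≤ 1}

/-- The unit ball of the projective tensor product is the closed convex hull of the elementary
tensors of elements of the unit balls. -/
theorem mem_closure_convexHull_unitTensors {z : StrongDual ℝ (BilForm E F)}
    (hz : z ∈ projTensorSubmodule E F) (hz1 : ‖z‖ ≤ 1) :
    z ∈ closure (convexHull ℝ (unitTensors E F)) := by
  by_contra h
  obtain ⟨Φ, s, hs, hsz⟩ := geometric_hahn_banach_closed_point
    (convex_convexHull ℝ (unitTensors E F)).closure isClosed_closure h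
  -- The separating functional acts on the tensor product as a form; its bound `s` on unit tensors
  -- bounds the norm of that form, contradicting `s < Φ z`.
  have hΦ : ∀ (x : E) (y : F), ‖x‖ ≤ 1 → ‖y‖ ≤ 1 → inducedForm Φ x y ≤ s := fun x y hx hy =>
    (hs _ (subset_closure (subset_convexHull ℝ _ ⟨(x, y), ⟨hx, hy⟩, rfl⟩))).le
  have hs0 : 0 ≤ s := by simpa using hΦ 0 0 (by simp) (by simp)
  have habs : ∀ (x : E) (y : F), ‖x‖ ≤ 1 → ‖y‖ ≤ 1 → ‖inducedForm Φ x y‖ ≤ s :=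
    fun x y hx hy => abs_le.2 ⟨by
      have := hΦ (-x) y (by simpa using hx) hy
      simp only [map_neg, neg_apply] at this
      linarith, hΦ x y hx hy⟩
  have hnorm : ‖inducedForm Φ‖ ≤ s :=
    ContinuousLinearMap.opNorm_le_of_unit_norm hs0 fun x hx =>
      ContinuousLinearMap.opNorm_le_of_unit_norm hs0 fun y hy => habs x y hx.le hy.le
  have h1 : z (inducedForm Φ) ≤ s := calc
    z (inducedForm Φ) ≤ ‖z (inducedForm Φ)‖ := le_abs_self _
    _ ≤ ‖z‖ * ‖inducedForm Φ‖ := z.le_opNorm _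
    _ ≤ 1 * s := by gcongr
    _ = s := one_mul s
  rw [apply_inducedForm Φ hz] at h1
  exact absurd hsz (not_lt.2 h1)

/-- A point of a convex hull uses finitely many tensors, and these control its values. The error `1
/ 4` lets four times the remainder stay in the unit ball, so the step can be iterated. -/
theorem exists_finset_convexHull_approx {z : StrongDual ℝ (BilForm E F)}
    (hz : z ∈ projTensorSubmodule E F) (hz1 : ‖z‖ ≤ 1) :
    ∃ (S : Finset (E × F)) (u : StrongDual ℝ (BilForm E F)),
      (∀ p ∈ S, ‖p.1‖ ≤ 1 ∧ ‖p.2‖ ≤ 1) ∧ u ∈ projTensorSubmodule E F ∧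
      (∀ (B : BilForm E F) (c : ℝ), (∀ p ∈ S, |B p.1 p.2| ≤ c) → |u B| ≤ c) ∧
      ‖z - u‖ ≤ 1 / 4 := by
  classical
  obtain ⟨u, hu, hzu⟩ := Metric.mem_closure_iff.1 (mem_closure_convexHull_unitTensors hz hz1)
    (1 / 4) (by norm_num)
  have huP : u ∈ projTensorSubmodule E F := by
    refine convexHull_min ?_ (projTensorSubmodule E F).convex hu
    rintro _ ⟨p, -, rfl⟩
    exact Submodule.le_topologicalClosure _ (Submodule.subset_span ⟨_, _, rfl⟩)
  rw [convexHull_eq_union_convexHull_finite_subsets] at hu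
  simp only [Set.mem_iUnion] at hu
  obtain ⟨t, ht, hut⟩ := hu
  obtain ⟨S, hS, rfl⟩ := Finset.subset_set_image_iff.1 ht
  refine ⟨S, u, fun p hp => hS hp, huP, fun B c hB => ?_, ?_⟩
  · have hconv : Convex ℝ {v : StrongDual ℝ (BilForm E F) | |v B| ≤ c} := by
      have e : {v : StrongDual ℝ (BilForm E F) | |v B| ≤ c} =
          (ContinuousLinearMap.apply ℝ ℝ B : StrongDual ℝ (BilForm E F) →ₗ[ℝ] ℝ) ⁻¹'
            Metric.closedBall 0 c :=
        Set.ext fun v => (mem_closedBall_zero_iff (a := v B) (r := c)).symm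
      rw [e]
      exact (convex_closedBall (0 : ℝ) c).linear_preimage _
    refine convexHull_min ?_ hconv hut
    intro v hv
    simp only [Finset.coe_image, Set.mem_image] at hv
    obtain ⟨p, hp, rfl⟩ := hv
    exact hB p hp
  · rw [← dist_eq_norm]; exact hzu.le

/-- An element of the unit ball of the projective tensor product is a sum `∑ 4⁻ᵏ uₖ`, where `uₖ`
is a convex combination of elementary tensors from a finite subset of the unit balls. This is the
resulting bound on its values. -/
theorem exists_finset_control {z : StrongDual ℝ (BilForm E F)}
    (hz : z ∈ projTensorSubmodule E F) (hz1 : ‖z‖ ≤ 1) :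
    ∃ S : ℕ → Finset (E × F), (∀ k, ∀ p ∈ S k, ‖p.1‖ ≤ 1 ∧ ‖p.2‖ ≤ 1) ∧
      ∀ (B : BilForm E F) (c : ℝ), (∀ k, ∀ p ∈ S k, |B p.1 p.2| ≤ 2 ^ k * c) → |z B| ≤ 2 * c := by
  let W := {w : StrongDual ℝ (BilForm E F) // w ∈ projTensorSubmodule E F ∧ ‖w‖ ≤ 1}
  choose S u hS huP hu hzu using fun w : W => exists_finset_convexHull_approx w.2.1 w.2.2
  let next : W → W := fun w => ⟨(4 : ℝ) • (w.1 - u w),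
    Submodule.smul_mem _ _ (Submodule.sub_mem _ w.2.1 (huP w)), by
      rw [norm_smul, Real.norm_eq_abs, abs_of_pos (by norm_num : (0 : ℝ) < 4)]
      have := hzu w
      linarith⟩
  let w : ℕ → W := fun k => next^[k] ⟨z, hz, hz1⟩
  refine ⟨fun k => S (w k), fun k p hp => hS _ p hp, fun B c hB => ?_⟩
  have hstep : ∀ k, |(w k).1 B| ≤ 2 ^ k * c + |(w (k + 1)).1 B| / 4 := fun k => by
    have e : (w (k + 1)).1 B = 4 * ((w k).1 B - u (w k) B) := by
      simp only [w, Function.iterate_succ_apply']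
      rfl
    have h2 : |u (w k) B| ≤ 2 ^ k * c := hu (w k) B _ (hB k)
    have h3 := abs_add_le (u (w k) B) ((w k).1 B - u (w k) B)
    rw [add_sub_cancel] at h3
    rw [e, abs_mul, abs_of_pos (by norm_num : (0 : ℝ) < 4)]
    linarith
  -- The `k`-th term contributes at most `4⁻ᵏ · 2ᵏ c = 2⁻ᵏ c`; the geometric sum is `2c(1 - 2⁻ⁿ)`.
  have hsum : ∀ n : ℕ, |z B| ≤ 2 * c * (1 - (1 / 2) ^ n) + (1 / 4) ^ n * |(w n).1 B| := by
    intro n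
    induction n with
    | zero => simp [w]
    | succ n ih =>
      have h := mul_le_mul_of_nonneg_left (hstep n) (by positivity : (0 : ℝ) ≤ (1 / 4) ^ n)
      have e : ((1 : ℝ) / 4) ^ n * 2 ^ n = (1 / 2) ^ n := by rw [← mul_pow]; norm_num
      have e2 : ((1 : ℝ) / 4) ^ n * (2 ^ n * c + |(w (n + 1)).1 B| / 4) =
          (1 / 2) ^ n * c + (1 / 4) ^ n * |(w (n + 1)).1 B| / 4 := by rw [← e]; ring
      rw [e2] at h
      rw [pow_succ, pow_succ]
      linarith
  have hbound : ∀ n : ℕ, |z B| ≤ 2 * c * (1 - (1 / 2) ^ n) + (1 / 4) ^ n * ‖B‖ := fun n => by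
    refine (hsum n).trans ?_
    gcongr
    have h := (w n).1.le_opNorm B
    rw [Real.norm_eq_abs] at h
    exact h.trans (mul_le_of_le_one_left (norm_nonneg B) (w n).2.2)
  have hlim : Tendsto (fun n : ℕ => 2 * c * (1 - (1 / 2 : ℝ) ^ n) + (1 / 4) ^ n * ‖B‖) atTop
      (𝓝 (2 * c * (1 - 0) + 0 * ‖B‖)) :=
    ((tendsto_const_nhds.sub (tendsto_pow_atTop_nhds_zero_of_lt_one
      (by norm_num) (by norm_num))).const_mul _).add
      ((tendsto_pow_atTop_nhds_zero_of_lt_one (by norm_num) (by norm_num)).mul_const _)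
  simpa using ge_of_tendsto' hlim hbound

/-! ### The approximation property and forms of rank one -/

/-- The factors `2⁻ᵏ` make the points of the finite sets tend to `0`. Undoing the scaling costs the
factor `2ᵏ` that `exists_finset_control` tolerates. -/
theorem isCompact_insert_zero_scaled {S : ℕ → Finset E} (hS : ∀ k, ∀ x ∈ S k, ‖x‖ ≤ 1) :
    IsCompact (insert 0 (Set.range fun i : Σ k, S k => ((1 / 2 : ℝ) ^ i.1) • (i.2 : E))) := by
  apply Filter.Tendsto.isCompact_insert_range_of_cofinite
  rw [Metric.tendsto_nhds]
  intro ε hε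
  obtain ⟨n, hn⟩ := exists_pow_lt_of_lt_one hε (by norm_num : (1 / 2 : ℝ) < 1)
  have hfin : Set.Finite {i : Σ k, S k | i.1 < n} := by
    have : {i : Σ k, S k | i.1 < n} = ⋃ k ∈ Set.Iio n, Set.range (Sigma.mk k) := by
      ext ⟨k, x⟩
      simp
    rw [this]
    exact (Set.finite_Iio n).biUnion fun k _ => Set.finite_range _
  filter_upwards [hfin.compl_mem_cofinite] with i hi
  have hi : n ≤ i.1 := not_lt.1 hi
  rw [dist_zero_right, norm_smul, norm_pow, Real.norm_eq_abs,
    abs_of_pos (by norm_num : (0 : ℝ) < 1 / 2)]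
  calc (1 / 2 : ℝ) ^ i.1 * ‖(i.2 : E)‖ ≤ (1 / 2) ^ i.1 * 1 := by
        gcongr; exact hS _ _ i.2.2
    _ ≤ (1 / 2) ^ n := by
        rw [mul_one]; exact pow_le_pow_of_le_one (by norm_num) (by norm_num) hi
    _ < ε := hn

/-- Under the approximation property, a sequence of finite subsets of the unit ball is
approximately fixed by finite rank operators, with errors that may grow like `2ᵏ`. -/
theorem HasAP.exists_finiteRank (h : HasAP E) {S : ℕ → Finset E} (hS : ∀ k, ∀ x ∈ S k, ‖x‖ ≤ 1)
    {ε : ℝ} (hε : 0 < ε) :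
    ∃ T : E →L[ℝ] E, FiniteDimensional ℝ (LinearMap.range (T : E →ₗ[ℝ] E)) ∧
      ∀ k, ∀ x ∈ S k, ‖T x - x‖ ≤ 2 ^ k * ε := by
  obtain ⟨T, hT, hK⟩ := h ε hε _ (isCompact_insert_zero_scaled hS)
  refine ⟨T, hT, fun k x hx => ?_⟩
  have h := hK _ (Set.mem_insert_of_mem _ ⟨⟨k, x, hx⟩, rfl⟩)
  simp only [map_smul] at h
  rw [← smul_sub, norm_smul, norm_pow, Real.norm_eq_abs,
    abs_of_pos (by norm_num : (0 : ℝ) < 1 / 2)] at h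
  have e : (2 : ℝ) ^ k * (1 / 2) ^ k = 1 := by rw [← mul_pow]; norm_num
  calc ‖T x - x‖ = 2 ^ k * ((1 / 2) ^ k * ‖T x - x‖) := by rw [← mul_assoc, e, one_mul]
    _ ≤ 2 ^ k * ε := by gcongr

theorem ContinuousLinearMap.exists_eq_sum_of_finiteRank (T : E →L[ℝ] E)
    (hT : FiniteDimensional ℝ (LinearMap.range (T : E →ₗ[ℝ] E))) :
    ∃ (n : ℕ) (f : Fin n → StrongDual ℝ E) (e : Fin n → E), ∀ x, T x = ∑ j, f j x • e j := by
  let b := Module.finBasis ℝ (LinearMap.range (T : E →ₗ[ℝ] E))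
  let T' : E →L[ℝ] LinearMap.range (T : E →ₗ[ℝ] E) :=
    T.codRestrict _ fun x => LinearMap.mem_range_self _ x
  refine ⟨_, fun j => (LinearMap.toContinuousLinearMap (b.coord j)).comp T',
    fun j => (b j : E), fun x => ?_⟩
  have h := congrArg (Subtype.val) (b.sum_repr (T' x))
  rw [AddSubmonoidClass.coe_finsetSum] at h
  exact h.symm

/-- If one of the factors has the approximation property, an element of the projective tensor
product that vanishes on all forms of rank one is zero. -/
theorem eq_zero_of_forall_rankOne (hAP : HasAP E ∨ HasAP F) {z : StrongDual ℝ (BilForm E F)}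
    (hz : z ∈ projTensorSubmodule E F)
    (h0 : ∀ (f : StrongDual ℝ E) (g : StrongDual ℝ F), z (f.smulRight g) = 0) : z = 0 := by
  classical
  wlog hz1 : ‖z‖ ≤ 1 generalizing z
  · have hpos : 0 < ‖z‖ := one_pos.trans (not_le.1 hz1)
    have := this (z := ‖z‖⁻¹ • z) (Submodule.smul_mem _ _ hz) (fun f g => by
      simp [h0]) (by rw [norm_smul, norm_inv, norm_norm, inv_mul_cancel₀ hpos.ne'])
    rw [← smul_inv_smul₀ hpos.ne' z, this, smul_zero]
  obtain ⟨S, hS, hcontrol⟩ := exists_finset_control hz hz1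
  ext B
  rw [zero_apply, ← abs_nonpos_iff]
  refine le_of_forall_pos_le_add fun ε hε => ?_
  rw [zero_add]
  set η : ℝ := ε / (2 * (‖B‖ + 1)) with hη
  have hB : (0 : ℝ) < ‖B‖ + 1 := by positivity
  have hη0 : 0 < η := by positivity
  have hηB : 2 * (‖B‖ * η) ≤ ε := by
    have : 2 * ((‖B‖ + 1) * η) = ε := by rw [hη]; field_simp
    linarith
  -- `A` is `B` with a finite rank operator inserted in one variable: a sum of rank-one forms, hence
  -- killed by `z`.
  suffices ∃ A : BilForm E F, z A = 0 ∧
      ∀ k, ∀ p ∈ S k, |(A - B) p.1 p.2| ≤ 2 ^ k * (‖B‖ * η) by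
    obtain ⟨A, hA, hAB⟩ := this
    have h := hcontrol (A - B) _ hAB
    rw [map_sub, hA, zero_sub, abs_neg] at h
    exact h.trans hηB
  rcases hAP with hAP | hAP
  · obtain ⟨T, hT, hTS⟩ := hAP.exists_finiteRank (S := fun k => (S k).image Prod.fst)
      (fun k x hx => by
        obtain ⟨p, hp, rfl⟩ := Finset.mem_image.1 hx
        exact (hS k p hp).1) hη0
    obtain ⟨n, f, e, hfe⟩ := T.exists_eq_sum_of_finiteRank hT
    refine ⟨B.comp T, ?_, fun k p hp => ?_⟩
    · have : B.comp T = ∑ j, (f j).smulRight (B (e j)) := by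
        ext x y
        simp [hfe]
      rw [this, map_sum]
      exact Finset.sum_eq_zero fun j _ => h0 _ _
    · have e1 : (B.comp T - B) p.1 p.2 = B (T p.1 - p.1) p.2 := by simp
      rw [e1]
      calc |B (T p.1 - p.1) p.2| ≤ ‖B‖ * ‖T p.1 - p.1‖ * ‖p.2‖ := B.le_opNorm₂ _ _
        _ ≤ ‖B‖ * (2 ^ k * η) * 1 := by
          gcongr
          · exact hTS k _ (Finset.mem_image_of_mem _ hp)
          · exact (hS k p hp).2
        _ = 2 ^ k * (‖B‖ * η) := by ring
  · obtain ⟨T, hT, hTS⟩ := hAP.exists_finiteRank (S := fun k => (S k).image Prod.snd)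
      (fun k x hx => by
        obtain ⟨p, hp, rfl⟩ := Finset.mem_image.1 hx
        exact (hS k p hp).2) hη0
    obtain ⟨n, f, e, hfe⟩ := T.exists_eq_sum_of_finiteRank hT
    refine ⟨(B.flip.comp T).flip, ?_, fun k p hp => ?_⟩
    · have : (B.flip.comp T).flip = ∑ j, (B.flip (e j)).smulRight (f j) := by
        ext x y
        simp [hfe, mul_comm]
      rw [this, map_sum]
      exact Finset.sum_eq_zero fun j _ => h0 _ _
    · have e1 : ((B.flip.comp T).flip - B) p.1 p.2 = B p.1 (T p.2 - p.2) := by simp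
      rw [e1]
      calc |B p.1 (T p.2 - p.2)| ≤ ‖B‖ * ‖p.1‖ * ‖T p.2 - p.2‖ := B.le_opNorm₂ _ _
        _ ≤ ‖B‖ * 1 * (2 ^ k * η) := by
          gcongr
          · exact (hS k p hp).1
          · exact hTS k _ (Finset.mem_image_of_mem _ hp)
        _ = 2 ^ k * (‖B‖ * η) := by ring

/-- If `A f` is a form given by an element of `G` on each elementary tensor, then so it is on each
element of the projective tensor product. -/
theorem exists_apply_eq_of_forall_tensor {G : Type*} [NormedAddCommGroup G] [NormedSpace ℝ G]
    [CompleteSpace G] (A : StrongDual ℝ G →L[ℝ] BilForm E F)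
    (hA : ∀ x y, ∃ e : G, ∀ f, A f x y = f e) {z : StrongDual ℝ (BilForm E F)}
    (hz : z ∈ projTensorSubmodule E F) : ∃ e : G, ∀ f, z (A f) = f e := by
  let J := NormedSpace.inclusionInDoubleDualLi ℝ (E := G)
  let R : StrongDual ℝ (BilForm E F) →L[ℝ] StrongDual ℝ (StrongDual ℝ G) :=
    (ContinuousLinearMap.compL ℝ (StrongDual ℝ G) (BilForm E F) ℝ).flip A
  -- Completeness of `G` makes its image in the bidual closed, so the condition passes from
  -- elementary tensors to their closed span.
  have hclosed : IsClosed (LinearMap.range J.toLinearMap : Set (StrongDual ℝ (StrongDual ℝ G))) := by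
    rw [LinearMap.coe_range]
    exact J.isometry.isClosedEmbedding.isClosed_range
  have hle : projTensorSubmodule E F ≤
      (LinearMap.range J.toLinearMap).comap (R : StrongDual ℝ (BilForm E F) →ₗ[ℝ] _) := by
    refine Submodule.topologicalClosure_minimal _ (Submodule.span_le.2 ?_)
      (hclosed.preimage R.continuous)
    rintro _ ⟨x, y, rfl⟩
    obtain ⟨e, he⟩ := hA x y
    exact ⟨e, by ext f; exact (he f).symm⟩
  obtain ⟨e, he⟩ := hle hz
  exact ⟨e, fun f => (DFunLike.congr_fun he f).symm⟩

end ProjTensor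

/-! ### Free spaces and the cone of multiples of evaluations -/

section FreeSpace

variable {M : Type*} [MetricSpace M] {o : M}

instance : CompleteSpace (FreeSpace M o) :=
  inferInstanceAs (CompleteSpace (Submodule.topologicalClosure _))

/-- The functional on `F(M)` given by a Lipschitz function. -/
noncomputable def FreeSpace.evalLip (h : LipZero M o) : StrongDual ℝ (FreeSpace M o) :=
  (ContinuousLinearMap.apply ℝ ℝ h).comp (freeSubmodule M o).subtypeL

theorem FreeSpace.evalLip_delta (h : LipZero M o) (m : M) : evalLip h (delta o m) = h m := rfl

theorem FreeSpace.abs_evalLip_le (h : LipZero M o) (v : FreeSpace M o) :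
    |evalLip h v| ≤ ‖v‖ * ‖h‖ :=
  (v.1).le_opNorm h

theorem LipZero.norm_le {f : LipZero M o} {C : ℝ} (hC : 0 ≤ C)
    (h : ∀ x y, |f x - f y| ≤ C * dist x y) : ‖f‖ ≤ C :=
  lipNorm_le hC h

/-- A `1`-Lipschitz function vanishing at the base point, as an element of `Lip₀(M)`. -/
def LipZero.ofLipschitz (f : M → ℝ) (hf : LipschitzWith 1 f) (h0 : f o = 0) : LipZero M o :=
  ⟨f, ⟨1, hf⟩, h0⟩

theorem LipZero.norm_ofLipschitz_le (f : M → ℝ) (hf : LipschitzWith 1 f) (h0 : f o = 0) :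
    ‖ofLipschitz f hf h0‖ ≤ 1 :=
  norm_le zero_le_one fun x y => hf.dist_le_mul x y

theorem norm_delta_sub_le (m p : M) : ‖delta o m - delta o p‖ ≤ dist m p := by
  refine ContinuousLinearMap.opNorm_le_bound (evalDelta o m - evalDelta o p) dist_nonneg
    fun f => ?_
  rw [mul_comm]
  exact f.abs_sub_le m p

theorem delta_base : delta o o = 0 :=
  norm_le_zero_iff.1 (ContinuousLinearMap.opNorm_le_bound (evalDelta o o) le_rfl fun f => by
    rw [zero_mul]
    exact (norm_eq_zero.2 f.map_base).le)

theorem continuous_delta : Continuous (delta o : M → FreeSpace M o) :=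
  (LipschitzWith.of_dist_le_mul (K := 1) fun x y => by
    rw [dist_eq_norm, NNReal.coe_one, one_mul]
    exact norm_delta_sub_le x y).continuous

theorem norm_delta (m : M) : ‖delta o m‖ = dist m o := by
  refine le_antisymm (by simpa [delta_base] using norm_delta_sub_le (o := o) m o) ?_
  let h := LipZero.ofLipschitz (o := o) (fun x => dist x o) (LipschitzWith.dist_left o)
    (dist_self o)
  have h1 := FreeSpace.abs_evalLip_le h (delta o m)
  have h2 : ‖h‖ ≤ 1 := LipZero.norm_ofLipschitz_le _ _ _
  calc dist m o ≤ |FreeSpace.evalLip h (delta o m)| := le_abs_self (dist m o)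
    _ ≤ ‖delta o m‖ * 1 := h1.trans (by gcongr)
    _ = _ := mul_one _

/-- A bump function around `m` separates multiples of `δ(m)` from multiples of `δ(p)`. -/
theorem abs_mul_min_le_norm_sub (a b : ℝ) (m p : M) :
    |a| * min (dist m o) (dist p m) ≤ ‖a • delta o m - b • delta o p‖ := by
  -- The largest height for which the bump vanishes at both `o` and `p`.
  set t := min (dist m o) (dist p m)
  have ht : 0 ≤ t := le_min dist_nonneg dist_nonneg
  have hlip : LipschitzWith 1 fun x => max 0 (t - dist x m) :=
    LipschitzWith.const_max (LipschitzWith.of_le_add fun x y => by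
      have := dist_triangle y x m
      rw [dist_comm y x] at this
      linarith) 0
  let h := LipZero.ofLipschitz (o := o) _ hlip (max_eq_left (by
    have : t ≤ dist m o := min_le_left _ _
    rw [dist_comm o m]; linarith))
  have hm : h m = t := by
    change max 0 (t - dist m m) = t
    rw [dist_self, sub_zero, max_eq_right ht]
  have hp : h p = 0 := max_eq_left (sub_nonpos.2 (min_le_right _ _))
  have h1 := FreeSpace.abs_evalLip_le h (a • delta o m - b • delta o p)
  have h2 : ‖h‖ ≤ 1 := LipZero.norm_ofLipschitz_le _ _ _
  rw [map_sub, map_smul, map_smul, FreeSpace.evalLip_delta, FreeSpace.evalLip_delta, hm, hp,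
    smul_zero, sub_zero, smul_eq_mul, abs_mul, abs_of_nonneg ht] at h1
  exact h1.trans (mul_le_of_le_one_right (norm_nonneg _) h2)

/-- The multiples of the evaluations `δ(m)`. -/
def deltaCone (M : Type*) [MetricSpace M] (o : M) : Set (FreeSpace M o) :=
  Set.range fun p : ℝ × M => p.1 • delta o p.2

/-- For `aₙ δ(mₙ) → γ ≠ 0` the norms `|aₙ| d(mₙ, o)` stay away from `0`, so the bump estimate makes
`mₙ` Cauchy, with limit different from `o`. Evaluating at `d(·, o)` then shows that `aₙ` converges.
-/
theorem isClosed_deltaCone [CompleteSpace M] : IsClosed (deltaCone M o) := by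
  refine isClosed_of_closure_subset fun γ hγ => ?_
  by_cases hγ0 : γ = 0
  · exact ⟨(0, o), by simp [hγ0]⟩
  obtain ⟨v, hv, hvγ⟩ := mem_closure_iff_seq_limit.1 hγ
  choose q hq using hv
  obtain rfl : (fun n => (q n).1 • delta o (q n).2) = v := funext hq
  set a : ℕ → ℝ := fun n => (q n).1
  set m : ℕ → M := fun n => (q n).2
  change Tendsto (fun n => a n • delta o (m n)) atTop (𝓝 γ) at hvγ
  have hc : 0 < ‖γ‖ := norm_pos_iff.2 hγ0
  have hnorm : ∀ᶠ n in atTop, ‖γ‖ / 2 < |a n| * dist (m n) o := by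
    filter_upwards [hvγ.norm.eventually_const_lt (half_lt_self hc)] with n hn
    rwa [norm_smul, norm_delta, Real.norm_eq_abs] at hn
  have key : ∀ η : ℝ, 0 < η → η < 1 → ∃ N, ∀ n ≥ N, ∀ k ≥ N,
      dist (m k) (m n) ≤ η * dist (m n) o := by
    intro η hη hη1
    obtain ⟨N₁, hN₁⟩ := eventually_atTop.1 hnorm
    obtain ⟨N₂, hN₂⟩ := Metric.cauchySeq_iff.1 hvγ.cauchySeq (η * (‖γ‖ / 2)) (by positivity)
    refine ⟨max N₁ N₂, fun n hn k hk => ?_⟩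
    have h1 := hN₁ n (le_of_max_le_left hn)
    have h2 := hN₂ n (le_of_max_le_right hn) k (le_of_max_le_right hk)
    rw [dist_eq_norm] at h2
    have h3 := (abs_mul_min_le_norm_sub (o := o) (a n) (a k) (m n) (m k)).trans_lt h2
    have ha : 0 < |a n| := pos_of_mul_pos_left ((half_pos hc).trans h1) dist_nonneg
    have h4 : min (dist (m n) o) (dist (m k) (m n)) < η * dist (m n) o := by
      refine lt_of_mul_lt_mul_left (h3.trans ?_) ha.le
      have := mul_lt_mul_of_pos_left h1 hη
      linarith
    -- As `η < 1`, the minimum cannot be `d(mₙ, o)`.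
    rcases min_lt_iff.1 h4 with h | h
    · exact absurd h (not_lt.2 (mul_le_of_le_one_left dist_nonneg hη1.le))
    · exact h.le
  obtain ⟨N, hN⟩ := key (1 / 2) (by norm_num) (by norm_num)
  have hr : ∀ n ≥ N, dist (m n) o ≤ 2 * dist (m N) o := fun n hn => by
    have h1 := hN N le_rfl n hn
    have h2 := dist_triangle (m n) (m N) o
    have h3 : 0 ≤ dist (m N) o := dist_nonneg
    linarith
  have hcauchy : CauchySeq m := by
    refine Metric.cauchySeq_iff'.2 fun ε hε => ?_
    set r := dist (m N) o
    have hr0 : 0 ≤ r := dist_nonneg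
    obtain ⟨N', hN'⟩ := key (min (1 / 2) (ε / (2 * r + 1))) (by positivity)
      ((min_le_left _ _).trans_lt (by norm_num))
    refine ⟨max N N', fun n hn => ?_⟩
    calc dist (m n) (m (max N N'))
        ≤ min (1 / 2) (ε / (2 * r + 1)) * dist (m (max N N')) o :=
          hN' _ (le_max_right _ _) _ (le_of_max_le_right hn)
      _ ≤ ε / (2 * r + 1) * (2 * r) := by
          gcongr
          · exact min_le_right _ _
          · exact hr _ (le_max_left _ _)
      _ < ε := by
          rw [div_mul_eq_mul_div, div_lt_iff₀ (by positivity)]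
          linarith
  obtain ⟨p, hp⟩ := cauchySeq_tendsto_of_complete hcauchy
  -- All later points, hence `p`, lie within half of `d(m_N, o)` from `m_N`.
  have hpo : 0 < dist p o := by
    have hlim : dist p (m N) ≤ 1 / 2 * dist (m N) o :=
      le_of_tendsto (hp.dist tendsto_const_nhds)
        (eventually_atTop.2 ⟨N, fun k hk => hN N le_rfl k hk⟩)
    have hN0 : 0 < dist (m N) o := by
      refine lt_of_le_of_ne dist_nonneg fun h => ?_
      obtain ⟨n, hn, hnN⟩ := (hnorm.and (eventually_ge_atTop N)).exists
      have h1 := hr n hnN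
      rw [← h, mul_zero] at h1
      rw [le_antisymm h1 dist_nonneg, mul_zero] at hn
      linarith
    have := dist_triangle_left (m N) o p
    linarith
  let h := LipZero.ofLipschitz (o := o) (fun x => dist x o) (LipschitzWith.dist_left o)
    (dist_self o)
  have h1 : Tendsto (fun n => a n * dist (m n) o) atTop (𝓝 (FreeSpace.evalLip h γ)) := by
    refine (((FreeSpace.evalLip h).continuous.tendsto γ).comp hvγ).congr fun n => ?_
    simp only [Function.comp_apply, map_smul, FreeSpace.evalLip_delta, smul_eq_mul]
    rfl
  have hpd : Tendsto (fun n => dist (m n) o) atTop (𝓝 (dist p o)) := hp.dist tendsto_const_nhds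
  have h2 : Tendsto a atTop (𝓝 (FreeSpace.evalLip h γ / dist p o)) := by
    refine (h1.div hpd hpo.ne').congr' ?_
    filter_upwards [hpd.eventually_const_lt hpo] with n hn
    exact mul_div_cancel_right₀ _ hn.ne'
  exact ⟨(_, p), tendsto_nhds_unique (h2.smul ((continuous_delta.tendsto p).comp hp)) hvγ⟩

/-- The elements of `F(M)` are approximated by finite combinations of evaluations, so that a
Lipschitz function vanishing on a suitable finite set is small on a given element. -/
theorem exists_finset_evalLip_le (γ : FreeSpace M o) {ε : ℝ} (hε : 0 < ε) :
    ∃ P : Finset M, ∀ h : LipZero M o, ‖h‖ ≤ 1 → (∀ p ∈ P, h p = 0) →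
      |FreeSpace.evalLip h γ| ≤ ε := by
  have hγ : (γ.1 : StrongDual ℝ (LipZero M o)) ∈
      closure (Submodule.span ℝ (Set.range (evalDelta o)) :
        Set (StrongDual ℝ (LipZero M o))) := γ.2
  obtain ⟨μ, hμ, hγμ⟩ := Metric.mem_closure_iff.1 hγ ε hε
  have hfin : ∃ P : Finset M, ∀ h : LipZero M o, (∀ p ∈ P, h p = 0) → μ h = 0 := by
    classical
    clear hγμ
    induction hμ using Submodule.span_induction with
    | mem x hx =>
      obtain ⟨m, rfl⟩ := hx
      exact ⟨{m}, fun h hh => hh m (by simp)⟩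
    | zero => exact ⟨∅, fun _ _ => rfl⟩
    | add x y _ _ hx hy =>
      obtain ⟨P, hP⟩ := hx
      obtain ⟨Q, hQ⟩ := hy
      refine ⟨P ∪ Q, fun h hh => ?_⟩
      rw [add_apply, hP h fun p hp => hh p (Finset.mem_union_left _ hp),
        hQ h fun p hp => hh p (Finset.mem_union_right _ hp), add_zero]
    | smul c x _ hx =>
      obtain ⟨P, hP⟩ := hx
      exact ⟨P, fun h hh => by rw [smul_apply, hP h hh, smul_zero]⟩
  obtain ⟨P, hP⟩ := hfin
  refine ⟨P, fun h h1 hh => ?_⟩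
  have h2 := (γ.1 - μ).le_opNorm h
  have e : (γ.1 - μ) h = FreeSpace.evalLip h γ := by
    change γ.1 h - μ h = γ.1 h
    rw [hP h hh, sub_zero]
  rw [e, Real.norm_eq_abs] at h2
  rw [dist_eq_norm] at hγμ
  exact h2.trans ((mul_le_of_le_one_right (norm_nonneg _) h1).trans hγμ.le)

/-- The cone of multiples of evaluations is weakly closed. -/
theorem mem_deltaCone_of_weak_tendsto [CompleteSpace M] {ι : Type*} (l : Ultrafilter ι)
    (a : ι → ℝ) (m : ι → M) (γ : FreeSpace M o)
    (hlim : ∀ φ : StrongDual ℝ (FreeSpace M o),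
      Tendsto (fun i => a i * φ (delta o (m i))) l (𝓝 (φ γ))) : γ ∈ deltaCone M o := by
  classical
  refine isClosed_deltaCone.closure_subset (Metric.mem_closure_iff.2 fun ε hε => ?_)
  obtain ⟨P, hP⟩ := exists_finset_evalLip_le γ (by positivity : 0 < ε / 3)
  -- Adding `o` makes the distance to `Q` vanish at the base point. This function is small on `γ`,
  -- so `|aᵢ| d(mᵢ, Q)` is eventually small.
  let Q : Finset M := insert o P
  have hQ : (Q : Set M).Nonempty := ⟨o, by simp [Q]⟩
  let h := LipZero.ofLipschitz (o := o) (fun x => Metric.infDist x Q)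
    (Metric.lipschitz_infDist_pt _) (Metric.infDist_zero_of_mem (by simp [Q]))
  have hγ : |FreeSpace.evalLip h γ| ≤ ε / 3 :=
    hP h (LipZero.norm_ofLipschitz_le _ _ _) fun p hp =>
      Metric.infDist_zero_of_mem (by simp [Q, hp])
  have hev : ∀ᶠ i in (l : Filter ι), |a i| * Metric.infDist (m i) Q < ε / 2 := by
    filter_upwards [(hlim (FreeSpace.evalLip h)).abs.eventually_lt_const
      (hγ.trans_lt (by linarith : ε / 3 < ε / 2))] with i hi
    rwa [abs_mul, FreeSpace.evalLip_delta, show h (m i) = Metric.infDist (m i) Q from rfl,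
      abs_of_nonneg Metric.infDist_nonneg] at hi
  have hev' : ∀ᶠ i in (l : Filter ι), ∃ p ∈ Q, |a i| * dist (m i) p < ε / 2 := by
    filter_upwards [hev] with i hi
    obtain ⟨p, hp, hpd⟩ := Q.finite_toSet.isCompact.exists_infDist_eq_dist hQ (m i)
    exact ⟨p, hp, hpd ▸ hi⟩
  -- An ultrafilter selects one of the finitely many nearest points.
  obtain ⟨p, hp, hpl⟩ : ∃ p ∈ Q, ∀ᶠ i in (l : Filter ι), |a i| * dist (m i) p < ε / 2 :=
    (Ultrafilter.eventually_exists_mem_iff Q.finite_toSet).1 hev'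
  let L : Submodule ℝ (FreeSpace M o) := Submodule.span ℝ {delta o p}
  -- Eventually `aᵢ δ(mᵢ)` is within `ε / 2` of the line through `δ(p)`. The closed thickening of a
  -- line is convex, so by Hahn–Banach it contains the weak limit `γ`.
  have hmem : γ ∈ Metric.cthickening (ε / 2) (L : Set (FreeSpace M o)) := by
    by_contra hγL
    obtain ⟨φ, s, hs, hsγ⟩ := geometric_hahn_banach_closed_point
      (L.convex.cthickening (ε / 2)) Metric.isClosed_cthickening hγL
    refine absurd (le_of_tendsto (hlim φ) (b := s) ?_) (not_le.2 hsγ)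
    filter_upwards [hpl] with i hi
    rw [← smul_eq_mul, ← map_smul]
    refine (hs _ (Metric.mem_cthickening_of_dist_le _ (a i • delta o p) _ _
      (L.smul_mem _ (Submodule.mem_span_singleton_self _)) ?_)).le
    rw [dist_eq_norm, ← smul_sub, norm_smul, Real.norm_eq_abs]
    exact (mul_le_mul_of_nonneg_left (norm_delta_sub_le _ _) (abs_nonneg _)).trans hi.le
  obtain ⟨v, hv, hd⟩ := Metric.mem_thickening_iff.1
    (Metric.cthickening_subset_thickening' hε (half_lt_self hε) _ hmem)
  obtain ⟨c, rfl⟩ := Submodule.mem_span_singleton.1 hv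
  exact ⟨_, ⟨(c, p), rfl⟩, hd⟩

end FreeSpace

/-! ### Weak closedness of `δ(M, X)` -/

/-- Weak neighbourhoods of a closure point pull back to a proper filter on the index set, which an
ultrafilter refines. -/
theorem IsWeaklyClosed.of_forall_ultrafilter {ι E : Type*} [NormedAddCommGroup E] [NormedSpace ℝ E]
    (g : ι → E)
    (h : ∀ (z : E) (l : Ultrafilter ι),
      (∀ φ : StrongDual ℝ E, Tendsto (fun i => φ (g i)) l (𝓝 (φ z))) → z ∈ Set.range g) :
    IsWeaklyClosed (Set.range g) := by
  rw [IsWeaklyClosed, ← Set.range_comp]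
  refine isClosed_of_closure_subset fun w hw => ?_
  obtain ⟨z, rfl⟩ := (toWeakSpace ℝ E).surjective w
  have hne : NeBot (comap (toWeakSpace ℝ E ∘ g) (𝓝 (toWeakSpace ℝ E z))) := by
    refine comap_neBot fun t ht => ?_
    obtain ⟨_, hy, i, rfl⟩ := mem_closure_iff_nhds.1 hw t ht
    exact ⟨i, hy⟩
  obtain ⟨i, hi⟩ := h z (Ultrafilter.of (comap (toWeakSpace ℝ E ∘ g) (𝓝 (toWeakSpace ℝ E z))))
    fun φ => by
      have h1 : Tendsto (toWeakSpace ℝ E ∘ g) (Ultrafilter.of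
          (comap (toWeakSpace ℝ E ∘ g) (𝓝 (toWeakSpace ℝ E z)))) (𝓝 (toWeakSpace ℝ E z)) :=
        tendsto_comap.mono_left (Ultrafilter.of_le _)
      exact ((WeakBilin.eval_continuous (topDualPairing ℝ E).flip φ).tendsto _).comp h1
  exact ⟨i, congrArg _ hi⟩

theorem proposition2 {M : Type*} [MetricSpace M] [CompleteSpace M] (o : M)
    {X : Type*} [NormedAddCommGroup X] [NormedSpace ℝ X] [CompleteSpace X]
    (hAP : HasAP (FreeSpace M o) ∨ HasAP X) :
    IsWeaklyClosed (deltaSet M o X) := by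
  have hrange : deltaSet M o X = Set.range fun p : M × X => tensor (delta o p.1) p.2 := by
    ext z
    exact ⟨fun ⟨m, x, h⟩ => ⟨(m, x), h.symm⟩, fun ⟨p, h⟩ => ⟨p.1, p.2, h.symm⟩⟩
  rw [hrange]
  refine IsWeaklyClosed.of_forall_ultrafilter _ fun z l hl => ?_
  have hz : z.1 ∈ projTensorSubmodule (FreeSpace M o) X := z.2
  have hform : ∀ B : BilForm (FreeSpace M o) X,
      Tendsto (fun i : M × X => B (delta o i.1) i.2) l (𝓝 (z.1 B)) := fun B =>
    hl ((ContinuousLinearMap.apply ℝ ℝ B).comp (projTensorSubmodule (FreeSpace M o) X).subtypeL)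
  have hrank : ∀ (f : StrongDual ℝ (FreeSpace M o)) (g : StrongDual ℝ X),
      Tendsto (fun i : M × X => f (delta o i.1) * g i.2) l (𝓝 (z.1 (f.smulRight g))) :=
    fun f g => hform (f.smulRight g)
  suffices ∃ (m : M) (x : X), ∀ (f : StrongDual ℝ (FreeSpace M o)) (g : StrongDual ℝ X),
      z.1 (f.smulRight g) = f (delta o m) * g x by
    obtain ⟨m, x, h⟩ := this
    refine ⟨(m, x), Subtype.ext (Eq.symm (sub_eq_zero.1 (eq_zero_of_forall_rankOne hAP
      (Submodule.sub_mem _ hz (tensor (delta o m) x).2) fun f g => ?_)))⟩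
    change z.1 (f.smulRight g) - f (delta o m) * g x = 0
    rw [h, sub_self]
  by_cases h0 : ∀ (f : StrongDual ℝ (FreeSpace M o)) (g : StrongDual ℝ X),
      z.1 (f.smulRight g) = 0
  · exact ⟨o, 0, fun f g => by rw [h0, map_zero, mul_zero]⟩
  push Not at h0
  obtain ⟨f₀, g₀, hc⟩ := h0
  obtain ⟨γ, hγ⟩ := exists_apply_eq_of_forall_tensor
    ((ContinuousLinearMap.smulRightL ℝ (FreeSpace M o) (StrongDual ℝ X)).flip g₀)
    (fun e y => ⟨g₀ y • e, fun f => by simp [mul_comm]⟩) hz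
  obtain ⟨x, hx⟩ := exists_apply_eq_of_forall_tensor
    (ContinuousLinearMap.smulRightL ℝ (FreeSpace M o) (StrongDual ℝ X) f₀)
    (fun e y => ⟨f₀ e • y, fun g => by simp⟩) hz
  have hγ : ∀ f : StrongDual ℝ (FreeSpace M o), z.1 (f.smulRight g₀) = f γ := hγ
  have hx : ∀ g : StrongDual ℝ X, z.1 (f₀.smulRight g) = g x := hx
  obtain ⟨⟨b, m⟩, rfl⟩ := mem_deltaCone_of_weak_tendsto l (fun i : M × X => g₀ i.2) (fun i => i.1) γ
    fun φ => by
      rw [← hγ]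
      simpa only [mul_comm] using hrank φ g₀
  set c := z.1 (f₀.smulRight g₀)
  -- Since `γ = b δ(m)`, the tensor `c⁻¹ γ ⊗ x` is `δ(m) ⊗ (c⁻¹ b x)`.
  refine ⟨m, (c⁻¹ * b) • x, fun f g => ?_⟩
  have hprod : z.1 (f.smulRight g) * c = z.1 (f.smulRight g₀) * z.1 (f₀.smulRight g) := by
    refine tendsto_nhds_unique ((hrank f g).mul (hrank f₀ g₀))
      (((hrank f g₀).mul (hrank f₀ g)).congr fun i => ?_)
    ring
  rw [hγ, hx, map_smul, smul_eq_mul] at hprod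
  rw [map_smul, smul_eq_mul, eq_div_of_mul_eq hc hprod]
  field_simp
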